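/- Let $\mathbb{H}=\mathbb{R}$ or $\mathbb{H}=\mathbb{C}$ and let $d\ge 2$. Let $G(1,d)$ be the set of one-dimensional subspaces of $\mathbb{H}^d$ with the metric $d(V,W)=\|P_V-P_W\|_{\mathrm{Frob}}$, where $P_W$ is (the matrix of) the orthogonal projection onto $W$, let $\mathcal{M}(G(1,d))$ be the set of Borel probability measures on $G(1,d)$, and let $\mathbb{S}^{d-1}=\{x\in\mathbb{H}^d:\|x\|=1\}$. For $s>0$ and $\mu\in\mathcal{M}(G(1,d))$ define the order-$s$ Kaczmarz functional $$F_{\alpha_s}(\mu)=\sup_{x\in\mathbb{S}^{d-1}}\int_{G(1,d)}\bigl(1-\|P_W(x)\|^2\bigr)^s\,d\mu(W)$$ and the logarithmic Kaczmarz functional $$F_{\alpha_{\log}}(\mu)=\sup_{x\in\mathbb{S}^{d-1}}\int_{G(1,d)}\log\bigl(1-\|P_W(x)\|^2\bigr)\,d\mu(W)\in[-\infty,0],$$ with $\log 0=-\infty$. There is exactly one measure $\Gamma_{1,d}\in\mathcal{M}(G(1,d))$ that is invariant under the orthogonal group $\mathcal{O}(d)$ (if $\mathbb{H}=\mathbb{R}$),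 respectively the unitary group $\mathcal{U}(d)$ (if $\mathbb{H}=\mathbb{C}$), and it has the following properties. 1. For every $0<s<1$, $\Gamma_{1,d}$ is the unique minimizer of $F_{\alpha_s}$ over $\mathcal{M}(G(1,d))$. 2. $\Gamma_{1,d}$ is the unique minimizer of $F_{\alpha_{\log}}$ over $\mathcal{M}(G(1,d))$. -/

import Mathlib

open MeasureTheory

noncomputable section

/-- The Hilbert space `𝕜^d`, where `𝕜` is `ℝ` or `ℂ`, with its Euclidean norm. -/
abbrev Hd (𝕜 : Type*) [RCLike 𝕜] (d : ℕ) : Type _ := EuclideanSpace 𝕜 (Fin d)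

/-- The Grassmannian `G(k, d)` of all `k`-dimensional linear subspaces of `𝕜^d`. -/
def Grassmannian (𝕜 : Type*) [RCLike 𝕜] (k d : ℕ) : Type _ :=
  {W : Submodule 𝕜 (Hd 𝕜 d) // Module.finrank 𝕜 W = k}

namespace Grassmannian

variable {𝕜 : Type*} [RCLike 𝕜] {k d : ℕ}

/-- The orthogonal projection `P_W` of `𝕜^d` onto `W`. -/
def proj (W : Grassmannian 𝕜 k d) : Hd 𝕜 d →L[𝕜] Hd 𝕜 d :=
  W.1.starProjection

/-- The matrix of `P_W` with respect to the canonical basis. -/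
def projMatrix (W : Grassmannian 𝕜 k d) : Matrix (Fin d) (Fin d) 𝕜 :=
  (Matrix.toEuclideanCLM (n := Fin d) (𝕜 := 𝕜)).symm W.proj

theorem projMatrix_injective :
    Function.Injective (projMatrix : Grassmannian 𝕜 k d → Matrix (Fin d) (Fin d) 𝕜) := by
  intro V W h
  have h2 : V.proj = W.proj := (Matrix.toEuclideanCLM (n := Fin d) (𝕜 := 𝕜)).symm.injective h
  exact Subtype.ext (Submodule.starProjection_inj.mp h2)

/-- The metric `d(V, W) = ‖P_V - P_W‖` on the Grassmannian, with the Frobenius norm of matrices. -/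
instance instMetricSpace : MetricSpace (Grassmannian 𝕜 k d) :=
  MetricSpace.induced projMatrix projMatrix_injective
    Matrix.frobeniusNormedAddCommGroup.toMetricSpace

/-- The Borel `σ`-algebra of the Grassmannian. -/
instance instMeasurableSpace : MeasurableSpace (Grassmannian 𝕜 k d) := borel _

instance instBorelSpace : BorelSpace (Grassmannian 𝕜 k d) := ⟨rfl⟩

/-- The image `g(W)` of a subspace `W` under a linear isometry `g` of `𝕜^d` onto itself, that is,
under an element `g` of the orthogonal group (`𝕜 = ℝ`) or of the unitary group (`𝕜 = ℂ`). -/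
def image (g : Hd 𝕜 d ≃ₗᵢ[𝕜] Hd 𝕜 d) (W : Grassmannian 𝕜 k d) : Grassmannian 𝕜 k d :=
  ⟨W.1.map g.toLinearEquiv.toLinearMap, (g.toLinearEquiv.finrank_map_eq W.1).trans W.2⟩

/-- Invariance of a Borel probability measure on the Grassmannian under the orthogonal group
(`𝕜 = ℝ`) or the unitary group (`𝕜 = ℂ`): `μ (g(S)) = μ S` for all `g` and all Borel sets `S`. -/
def IsInvariant (μ : ProbabilityMeasure (Grassmannian 𝕜 k d)) : Prop :=
  ∀ (g : Hd 𝕜 d ≃ₗᵢ[𝕜] Hd 𝕜 d) (S : Set (Grassmannian 𝕜 k d)), MeasurableSet S →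
    (μ : Measure (Grassmannian 𝕜 k d)) (image g '' S) = (μ : Measure (Grassmannian 𝕜 k d)) S

end Grassmannian

/-- The integral `∫ f⁺ dμ - ∫ f⁻ dμ` of an extended real valued function, for `f` bounded above
and `μ` finite. Its value is `⊥ = -∞` when the negative part has infinite integral. -/
def erealIntegral {Y : Type*} [MeasurableSpace Y] (f : Y → EReal) (μ : Measure Y) : EReal :=
  ((∫⁻ y, (f y).toENNReal ∂μ : ENNReal) : EReal) - ((∫⁻ y, (-f y).toENNReal ∂μ : ENNReal) : EReal)

/-- The order-`s` Kaczmarz functional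
`F_s(μ) = sup_{‖x‖ = 1} ∫_{G(k,d)} (1 - ‖P_W x‖²)^s dμ(W)`. -/
def kaczmarzFunctional {𝕜 : Type*} [RCLike 𝕜] {k d : ℕ} (s : ℝ)
    (μ : ProbabilityMeasure (Grassmannian 𝕜 k d)) : ℝ :=
  ⨆ x : Metric.sphere (0 : Hd 𝕜 d) 1,
    ∫ W : Grassmannian 𝕜 k d, (1 - ‖W.proj (x : Hd 𝕜 d)‖ ^ 2) ^ s ∂(μ : Measure _)

/-- The logarithmic kernel `log (1 - ‖P_W x‖²)`, which is `-∞` when `‖P_W x‖ = 1`. -/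
def logKernel {𝕜 : Type*} [RCLike 𝕜] {k d : ℕ} (x : Hd 𝕜 d) (W : Grassmannian 𝕜 k d) : EReal :=
  ENNReal.log (ENNReal.ofReal (1 - ‖W.proj x‖ ^ 2))

/-- The logarithmic Kaczmarz functional
`F_log(μ) = sup_{‖x‖ = 1} ∫_{G(k,d)} log (1 - ‖P_W x‖²) dμ(W)`, valued in `[-∞, 0]`. -/
def logKaczmarzFunctional {𝕜 : Type*} [RCLike 𝕜] {k d : ℕ}
    (μ : ProbabilityMeasure (Grassmannian 𝕜 k d)) : EReal :=
  ⨆ x : Metric.sphere (0 : Hd 𝕜 d) 1,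
    erealIntegral (fun W : Grassmannian 𝕜 k d => logKernel (x : Hd 𝕜 d) W) (μ : Measure _)

end

/-! For a unit vector spanning the line `X`, `‖P_W x‖²` is `t = tr (P_X P_W)`. On `[0, 1]` both `1 -
(1 - t)^s` and `-log (1 - t)` are power series `∑ aₙ tⁿ` with `aₙ > 0` for `n ≥ 1`
(`ennrealSeries_powerCoeff`, `ennrealSeries_inv`), and `tⁿ` is an inner product of tensor powers of
the projections (`inner_moment`). Minimizing the functional thus means maximizing the smallest value
of the potential of `μ` for a positive definite kernel.

An invariant `Γ` has a constant potential `C`, because isometries act transitively on lines. If `μ`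
does at least as well as `Γ`, its potential is everywhere at least `C`; by symmetry of the kernel
its `Γ`-mean is exactly `C`. Full support of `Γ` and lower semicontinuity force the potential to
equal `C` everywhere, so the energy of `μ` is at most that of `Γ`. Order by order, however, the two
energies differ by the squared distance of the mean tensors (`norm_integral_moment_sub_sq`). All
moments of `μ` and `Γ` therefore agree, and moments determine the measure
(`ext_of_integral_moment`). This is `eq_of_le_seriesPotential`.

The argument needs `C < ∞`, which is delicate only for the logarithm: there it follows from the
vanishing circle average of `log |z - a|` for `|a| ≤ 1` (`tsum_inv_isotropic_ne_top`). -/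

noncomputable section

/-! ### Projection matrices and the action of isometries -/

namespace Grassmannian

variable {𝕜 : Type*} [RCLike 𝕜] {k d : ℕ}

/-- The entries of the matrix of `P_W`, as a vector of the Euclidean space `𝕜^(d × d)`. -/
def entries (W : Grassmannian 𝕜 k d) : EuclideanSpace 𝕜 (Fin d × Fin d) :=
  WithLp.toLp 2 fun p => W.projMatrix p.1 p.2

theorem entries_isometry : Isometry (entries : Grassmannian 𝕜 k d → _) := by
  refine Isometry.of_dist_eq fun V W => ?_
  let _ := Matrix.frobeniusNormedAddCommGroup (m := Fin d) (n := Fin d) (α := 𝕜)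
  have h : dist V W = ‖V.projMatrix - W.projMatrix‖ := by
    rw [← dist_eq_norm]; rfl
  rw [h, Matrix.frobenius_norm_def, EuclideanSpace.dist_eq, Real.sqrt_eq_rpow]
  simp [entries, Fintype.sum_prod_type, dist_eq_norm]

theorem continuous_entries : Continuous (entries : Grassmannian 𝕜 k d → _) :=
  entries_isometry.continuous

theorem toEuclideanCLM_projMatrix (W : Grassmannian 𝕜 k d) :
    Matrix.toEuclideanCLM (n := Fin d) (𝕜 := 𝕜) W.projMatrix = W.proj := by
  simp [projMatrix]

theorem proj_apply (W : Grassmannian 𝕜 k d) (x : Hd 𝕜 d) (i : Fin d) :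
    W.proj x i = ∑ j, W.projMatrix i j * x j := by
  rw [← toEuclideanCLM_projMatrix, Matrix.ofLp_toEuclideanCLM]
  simp [Matrix.mulVec, dotProduct]

theorem entries_apply (W : Grassmannian 𝕜 k d) (p : Fin d × Fin d) :
    W.entries p = W.proj (EuclideanSpace.single p.2 1) p.1 := by
  rw [proj_apply, Finset.sum_eq_single p.2] <;> simp +contextual [entries]

theorem inner_proj_self (W : Grassmannian 𝕜 k d) (x : Hd 𝕜 d) :
    inner 𝕜 x (W.proj x) = ((‖W.proj x‖ ^ 2 : ℝ) : 𝕜) := by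
  have h : W.proj (W.proj x) = W.proj x := by
    simp only [proj]
    exact Submodule.starProjection_eq_self_iff.2 (Submodule.starProjection_apply_mem _ _)
  rw [← h, proj, ← Submodule.inner_starProjection_left_eq_right, ← proj, h,
    inner_self_eq_norm_sq_to_K]
  simp

theorem norm_proj_le (W : Grassmannian 𝕜 k d) (x : Hd 𝕜 d) : ‖W.proj x‖ ≤ ‖x‖ :=
  Submodule.norm_starProjection_apply_le _ _

theorem proj_image (g : Hd 𝕜 d ≃ₗᵢ[𝕜] Hd 𝕜 d) (W : Grassmannian 𝕜 k d) (x : Hd 𝕜 d) :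
    (image g W).proj x = g (W.proj (g.symm x)) :=
  Submodule.starProjection_map_apply g W.1 x

theorem continuous_image (g : Hd 𝕜 d ≃ₗᵢ[𝕜] Hd 𝕜 d) :
    Continuous (image g : Grassmannian 𝕜 k d → Grassmannian 𝕜 k d) := by
  rw [entries_isometry.isEmbedding.continuous_iff, ← (PiLp.homeomorph 2 _).comp_continuous_iff]
  refine continuous_pi fun p => ?_
  change Continuous fun W : Grassmannian 𝕜 k d => (image g W).entries p
  simp only [entries_apply, proj_image]
  refine (PiLp.continuous_apply 2 _ p.1).comp (g.continuous.comp ?_)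
  rw [← (PiLp.homeomorph 2 _).comp_continuous_iff]
  refine continuous_pi fun i => ?_
  change Continuous fun W : Grassmannian 𝕜 k d => W.proj _ i
  simp only [proj_apply]
  refine continuous_finsetSum _ fun j _ => Continuous.mul ?_ continuous_const
  exact (PiLp.continuous_apply 2 _ (i, j)).comp continuous_entries

theorem image_symm_image (g : Hd 𝕜 d ≃ₗᵢ[𝕜] Hd 𝕜 d) (W : Grassmannian 𝕜 k d) :
    image g.symm (image g W) = W := by
  apply Subtype.ext
  ext x
  simp [image]

theorem image_eq_preimage (g : Hd 𝕜 d ≃ₗᵢ[𝕜] Hd 𝕜 d) (S : Set (Grassmannian 𝕜 k d)) :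
    image g '' S = image g.symm ⁻¹' S :=
  congrFun (Set.image_eq_preimage_of_inverse (image_symm_image g) (image_symm_image g.symm)) S

/-- The kernel `tr (P_X P_W)`. -/
def overlap (X W : Grassmannian 𝕜 1 d) : ℝ := RCLike.re (inner 𝕜 X.entries W.entries)

/-! ### Lines spanned by unit vectors -/

section Line

variable [Nonempty (Grassmannian 𝕜 1 d)]

open Classical in
/-- The line spanned by a vector, with an arbitrary value at the zero vector. -/
def line (x : Hd 𝕜 d) : Grassmannian 𝕜 1 d :=
  if hx : x = 0 then Classical.arbitrary _ else ⟨𝕜 ∙ x, finrank_span_singleton hx⟩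

theorem line_coe {x : Hd 𝕜 d} (hx : x ≠ 0) : (line x).1 = 𝕜 ∙ x := by
  simp [line, hx]

theorem exists_line_eq (W : Grassmannian 𝕜 1 d) : ∃ x : Hd 𝕜 d, ‖x‖ = 1 ∧ line x = W := by
  obtain ⟨v, hv, hs⟩ := finrank_eq_one_iff'.1 W.2
  have hv0 : (v : Hd 𝕜 d) ≠ 0 := by simpa using hv
  have hn : ‖(v : Hd 𝕜 d)‖ ≠ 0 := norm_ne_zero_iff.2 hv0
  have hc : ((‖(v : Hd 𝕜 d)‖⁻¹ : ℝ) : 𝕜) ≠ 0 := by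
    simpa using hv
  have hx : ‖((‖(v : Hd 𝕜 d)‖⁻¹ : ℝ) : 𝕜) • (v : Hd 𝕜 d)‖ = 1 := by
    rw [norm_smul, RCLike.norm_ofReal, abs_of_nonneg (by positivity)]
    field_simp
  refine ⟨_, hx, Subtype.ext ?_⟩
  rw [line_coe (smul_ne_zero hc hv0), Submodule.span_singleton_smul_eq hc.isUnit]
  apply le_antisymm
  · rw [Submodule.span_singleton_le_iff_mem]; exact v.2
  · intro w hw
    obtain ⟨c, hc⟩ := hs ⟨w, hw⟩
    rw [Submodule.mem_span_singleton]
    exact ⟨c, by simpa using congrArg Subtype.val hc⟩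

theorem image_line (g : Hd 𝕜 d ≃ₗᵢ[𝕜] Hd 𝕜 d) {x : Hd 𝕜 d} (hx : x ≠ 0) :
    image g (line x) = line (g x) := by
  apply Subtype.ext
  have hg : g x ≠ 0 := by simpa using hx
  rw [line_coe hg]
  change (line x).1.map _ = _
  rw [line_coe hx, Submodule.map_span]
  simp

theorem line_proj {x : Hd 𝕜 d} (hx : x ≠ 0) (y : Hd 𝕜 d) :
    (line x).proj y = (inner 𝕜 x y / ((‖x‖ ^ 2 : ℝ) : 𝕜)) • x := by
  have : (line x).proj = (𝕜 ∙ x).starProjection := by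
    simp only [proj]
    congr 1
    exact line_coe hx
  rw [this, Submodule.starProjection_singleton]

theorem entries_line {x : Hd 𝕜 d} (hx : x ≠ 0) (p : Fin d × Fin d) :
    (line x).entries p = (starRingEnd 𝕜 (x p.2) / ((‖x‖ ^ 2 : ℝ) : 𝕜)) * x p.1 := by
  rw [entries_apply, line_proj hx, PiLp.smul_apply, smul_eq_mul,
    EuclideanSpace.inner_single_right, one_mul]

theorem continuousOn_line : ContinuousOn (line : Hd 𝕜 d → Grassmannian 𝕜 1 d) {0}ᶜ := by
  rw [entries_isometry.isEmbedding.isInducing.continuousOn_iff,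
    (PiLp.homeomorph 2 _).isInducing.continuousOn_iff]
  refine continuousOn_pi.2 fun p => ?_
  change ContinuousOn (fun x : Hd 𝕜 d => (line x).entries p) _
  have : ContinuousOn (fun x : Hd 𝕜 d =>
      (starRingEnd 𝕜 (x p.2) / ((‖x‖ ^ 2 : ℝ) : 𝕜)) * x p.1) {0}ᶜ := by
    refine ContinuousOn.mul (ContinuousOn.div ?_ ?_ ?_) ?_
    · exact (RCLike.continuous_conj.comp (PiLp.continuous_apply 2 _ p.2)).continuousOn
    · exact (RCLike.continuous_ofReal.comp (continuous_norm.pow 2)).continuousOn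
    · intro x hx
      simpa using hx
    · exact (PiLp.continuous_apply 2 _ p.1).continuousOn
  exact this.congr fun x hx => entries_line hx p

instance : CompactSpace (Grassmannian 𝕜 1 d) := by
  have : ProperSpace (Hd 𝕜 d) := FiniteDimensional.proper_rclike 𝕜 _
  refine ⟨?_⟩
  have h : (Set.univ : Set (Grassmannian 𝕜 1 d)) = line '' Metric.sphere (0 : Hd 𝕜 d) 1 := by
    refine (Set.eq_univ_of_forall fun W => ?_).symm
    obtain ⟨x, hx, h⟩ := exists_line_eq W
    exact ⟨x, by simpa using hx, h⟩
  rw [h]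
  refine (isCompact_sphere _ _).image_of_continuousOn (continuousOn_line.mono fun x hx => ?_)
  rintro rfl
  simp at hx

theorem measurable_line : Measurable (line : Hd 𝕜 d → Grassmannian 𝕜 1 d) :=
  measurable_of_continuousOn_compl_singleton 0 continuousOn_line

theorem inner_entries_line {x : Hd 𝕜 d} (hx : ‖x‖ = 1) (W : Grassmannian 𝕜 1 d) :
    inner 𝕜 (line x).entries W.entries = ((‖W.proj x‖ ^ 2 : ℝ) : 𝕜) := by
  have hx0 : x ≠ 0 := by rintro rfl; simp at hx
  rw [← inner_proj_self, PiLp.inner_apply, PiLp.inner_apply, Fintype.sum_prod_type]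
  refine Finset.sum_congr rfl fun i _ => ?_
  simp only [RCLike.inner_apply, entries_line hx0, proj_apply, hx, Finset.sum_mul]
  refine Finset.sum_congr rfl fun j _ => ?_
  simp [entries]
  ring

theorem overlap_line {x : Hd 𝕜 d} (hx : ‖x‖ = 1) (W : Grassmannian 𝕜 1 d) :
    overlap (line x) W = ‖W.proj x‖ ^ 2 := by
  rw [overlap, inner_entries_line hx, RCLike.ofReal_re]

/-- Realness matters when `𝕜 = ℂ`: it lets powers commute with taking real parts in
`re_inner_moment`. -/
theorem inner_entries (X W : Grassmannian 𝕜 1 d) :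
    inner 𝕜 X.entries W.entries = (overlap X W : 𝕜) := by
  obtain ⟨x, hx, rfl⟩ := exists_line_eq X
  rw [overlap_line hx, inner_entries_line hx]

theorem overlap_nonneg (X W : Grassmannian 𝕜 1 d) : 0 ≤ overlap X W := by
  obtain ⟨x, hx, rfl⟩ := exists_line_eq X
  rw [overlap_line hx]
  positivity

theorem overlap_le_one (X W : Grassmannian 𝕜 1 d) : overlap X W ≤ 1 := by
  obtain ⟨x, hx, rfl⟩ := exists_line_eq X
  rw [overlap_line hx]
  exact pow_le_one₀ (norm_nonneg _) ((norm_proj_le W x).trans hx.le)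

theorem overlap_image (g : Hd 𝕜 d ≃ₗᵢ[𝕜] Hd 𝕜 d) (X W : Grassmannian 𝕜 1 d) :
    overlap (image g X) (image g W) = overlap X W := by
  obtain ⟨x, hx, rfl⟩ := exists_line_eq X
  have hx0 : x ≠ 0 := by rintro rfl; simp at hx
  rw [image_line g hx0, overlap_line hx, overlap_line (by simpa using hx), proj_image]
  simp

/-- The isometry between the two lines matching unit vectors extends to the whole space, and is onto
by equality of dimensions. -/
theorem exists_image_eq (X Y : Grassmannian 𝕜 1 d) :
    ∃ g : Hd 𝕜 d ≃ₗᵢ[𝕜] Hd 𝕜 d, image g X = Y := by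
  obtain ⟨x, hx, rfl⟩ := exists_line_eq X
  obtain ⟨y, hy, rfl⟩ := exists_line_eq Y
  have hx0 : x ≠ 0 := by rintro rfl; simp at hx
  let e := (LinearIsometryEquiv.toSpanUnitSingleton (𝕜 := 𝕜) x hx).symm
  let f := LinearIsometry.toSpanSingleton 𝕜 (Hd 𝕜 d) hy
  let g := ((f.comp e.toLinearIsometry).extend).toLinearIsometryEquiv rfl
  refine ⟨g, ?_⟩
  rw [image_line g hx0]
  congr 1
  have h1 : e ⟨x, Submodule.mem_span_singleton_self x⟩ = 1 := by
    rw [LinearIsometryEquiv.symm_apply_eq]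
    ext
    simp
  have := (f.comp e.toLinearIsometry).extend_apply ⟨x, Submodule.mem_span_singleton_self x⟩
  change (f.comp e.toLinearIsometry).extend x = y
  rw [this]
  change f (e _) = y
  rw [h1]
  simp [f]

end Line

end Grassmannian

/-! ### Existence of an invariant measure of full support -/

/-- Uniqueness of Haar measure leaves a scalar factor; it is 1 because the unit ball is preserved
and has finite positive measure. -/
theorem LinearIsometryEquiv.map_addHaar_eq {𝕜 E : Type*} [RCLike 𝕜] [NormedAddCommGroup E]
    [NormedSpace 𝕜 E] [ProperSpace E] [MeasurableSpace E] [BorelSpace E]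
    (g : E ≃ₗᵢ[𝕜] E) (μ : Measure E) [μ.IsAddHaarMeasure] : μ.map g = μ := by
  have : SecondCountableTopology E := secondCountable_of_proper
  have : (μ.map g).IsAddHaarMeasure :=
    AddEquiv.isAddHaarMeasure_map μ g.toLinearEquiv.toAddEquiv g.continuous g.symm.continuous
  rw [Measure.isAddLeftInvariant_eq_smul (μ.map g) μ]
  have h := congrArg (fun ν : Measure E => ν (Metric.ball 0 1))
    (Measure.isAddLeftInvariant_eq_smul (μ.map g) μ)
  have hb : g ⁻¹' Metric.ball 0 1 = Metric.ball 0 1 := by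
    ext x; simp
  simp only [Measure.smul_apply] at h
  rw [Measure.map_apply g.continuous.measurable measurableSet_ball, hb] at h
  have h0 : μ (Metric.ball 0 1) ≠ 0 := (Metric.measure_ball_pos μ 0 one_pos).ne'
  have h1 : μ (Metric.ball 0 1) ≠ ⊤ := measure_ball_lt_top.ne
  have h2 : Measure.addHaarScalarFactor (μ.map g) μ = 1 := by
    rw [ENNReal.smul_def, smul_eq_mul] at h
    have := (ENNReal.mul_eq_right h0 h1).1 h.symm
    exact_mod_cast this
  rw [h2, one_smul]

namespace Grassmannian

variable {𝕜 : Type*} [RCLike 𝕜] {d : ℕ}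


section Uniform

variable [Nonempty (Grassmannian 𝕜 1 d)]

theorem measure_ball_diff_zero_ne_zero (μ : Measure (Hd 𝕜 d)) [μ.IsAddHaarMeasure] :
    μ (Metric.ball 0 2 \ {0}) ≠ 0 := by
  have ho : IsOpen (Metric.ball (0 : Hd 𝕜 d) 2 \ {0}) := Metric.isOpen_ball.sdiff isClosed_singleton
  refine (ho.measure_pos μ ?_).ne'
  obtain ⟨x, hx, -⟩ := exists_line_eq (Classical.arbitrary (Grassmannian 𝕜 1 d))
  refine ⟨x, by simp [hx], ?_⟩
  rintro rfl
  simp at hx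

/-- The distribution of the line through a random point of a punctured ball. -/
def uniform : Measure (Grassmannian 𝕜 1 d) :=
  haveI : ProperSpace (Hd 𝕜 d) := FiniteDimensional.proper_rclike 𝕜 _
  (ProbabilityTheory.cond (Measure.addHaar : Measure (Hd 𝕜 d)) (Metric.ball 0 2 \ {0})).map line

instance : IsProbabilityMeasure (uniform : Measure (Grassmannian 𝕜 1 d)) := by
  have : ProperSpace (Hd 𝕜 d) := FiniteDimensional.proper_rclike 𝕜 _
  have : IsProbabilityMeasure (ProbabilityTheory.cond (Measure.addHaar : Measure (Hd 𝕜 d))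
      (Metric.ball 0 2 \ {0})) :=
    ProbabilityTheory.cond_isProbabilityMeasure_of_finite (measure_ball_diff_zero_ne_zero _)
      ((measure_mono Set.sdiff_subset).trans_lt measure_ball_lt_top).ne
  exact Measure.isProbabilityMeasure_map measurable_line.aemeasurable

theorem map_image_uniform (g : Hd 𝕜 d ≃ₗᵢ[𝕜] Hd 𝕜 d) :
    (uniform : Measure (Grassmannian 𝕜 1 d)).map (image g) = uniform := by
  have : ProperSpace (Hd 𝕜 d) := FiniteDimensional.proper_rclike 𝕜 _
  have hg : Measurable g := g.continuous.measurable
  have hA : MeasurableSet (Metric.ball (0 : Hd 𝕜 d) 2 \ {0}) :=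
    measurableSet_ball.diff (measurableSet_singleton 0)
  have hpre : g ⁻¹' (Metric.ball (0 : Hd 𝕜 d) 2 \ {0}) = Metric.ball (0 : Hd 𝕜 d) 2 \ {0} := by
    ext x; simp
  have hc : (ProbabilityTheory.cond (Measure.addHaar : Measure (Hd 𝕜 d))
      (Metric.ball 0 2 \ {0})).map g =
      ProbabilityTheory.cond (Measure.addHaar : Measure (Hd 𝕜 d)) (Metric.ball 0 2 \ {0}) := by
    rw [ProbabilityTheory.cond, Measure.map_smul]
    congr 1
    nth_rw 1 [← hpre]
    rw [← Measure.restrict_map hg hA, g.map_addHaar_eq]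
  rw [uniform, Measure.map_map (continuous_image g).measurable measurable_line]
  conv_rhs => rw [← hc, Measure.map_map measurable_line hg]
  refine Measure.map_congr ?_
  rw [ProbabilityTheory.cond]
  refine Measure.ae_smul_measure ?_ _
  filter_upwards [ae_restrict_mem hA] with x hx
  exact image_line g (by simpa using hx.2)

instance : (uniform : Measure (Grassmannian 𝕜 1 d)).IsOpenPosMeasure := by
  have : ProperSpace (Hd 𝕜 d) := FiniteDimensional.proper_rclike 𝕜 _
  refine ⟨fun U hU ⟨W, hW⟩ h0 => ?_⟩
  have hA : IsOpen (Metric.ball (0 : Hd 𝕜 d) 2 \ {0}) := Metric.isOpen_ball.sdiff isClosed_singleton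
  rw [uniform, Measure.map_apply measurable_line hU.measurableSet,
    ProbabilityTheory.cond_apply hA.measurableSet] at h0
  have hfin : (Measure.addHaar (Metric.ball (0 : Hd 𝕜 d) 2 \ {0})) ≠ ⊤ :=
    ((measure_mono Set.sdiff_subset).trans_lt measure_ball_lt_top).ne
  have h1 := (mul_eq_zero.1 h0).resolve_left (ENNReal.inv_ne_zero.2 hfin)
  have ho : IsOpen ((Metric.ball (0 : Hd 𝕜 d) 2 \ {0}) ∩ line ⁻¹' U) :=
    (continuousOn_line.mono fun x hx => hx.2).isOpen_inter_preimage hA hU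
  refine (ho.measure_pos Measure.addHaar ?_).ne' h1
  obtain ⟨x, hx, rfl⟩ := exists_line_eq W
  refine ⟨x, ⟨by simp [hx], ?_⟩, hW⟩
  rintro rfl
  simp at hx

end Uniform

theorem isInvariant_iff (μ : ProbabilityMeasure (Grassmannian 𝕜 1 d)) :
    IsInvariant μ ↔ ∀ g : Hd 𝕜 d ≃ₗᵢ[𝕜] Hd 𝕜 d,
      (μ : Measure (Grassmannian 𝕜 1 d)).map (image g) = μ := by
  constructor
  · intro h g
    ext S hS
    rw [Measure.map_apply (continuous_image g).measurable hS, ← h g.symm S hS, image_eq_preimage]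
    rfl
  · intro h g S hS
    rw [image_eq_preimage, ← Measure.map_apply (continuous_image g.symm).measurable hS, h]

end Grassmannian

/-! ### Moments and mutual energies -/

namespace Grassmannian

variable {𝕜 : Type*} [RCLike 𝕜] {d : ℕ}

/-- All products of `n` entries of the matrix of `P_W`. -/
def moment (n : ℕ) (W : Grassmannian 𝕜 1 d) : EuclideanSpace 𝕜 (Fin n → Fin d × Fin d) :=
  WithLp.toLp 2 fun I => ∏ k, W.entries (I k)

/-- `moment n` is the `n`-th tensor power of the projection matrix, and inner products of tensor
powers multiply. This is the source of positive definiteness. -/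
theorem inner_moment (n : ℕ) (X W : Grassmannian 𝕜 1 d) :
    inner 𝕜 (moment n X) (moment n W) = inner 𝕜 X.entries W.entries ^ n := by
  simp only [PiLp.inner_apply, RCLike.inner_apply]
  rw [Fintype.sum_pow]
  simp [moment, Finset.prod_mul_distrib]

theorem continuous_moment (n : ℕ) :
    Continuous (moment n : Grassmannian 𝕜 1 d → EuclideanSpace 𝕜 (Fin n → Fin d × Fin d)) := by
  rw [← (PiLp.homeomorph 2 _).comp_continuous_iff]
  refine continuous_pi fun I => ?_
  change Continuous fun W : Grassmannian 𝕜 1 d => ∏ k, W.entries (I k)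
  exact continuous_finsetProd _ fun k _ =>
    (PiLp.continuous_apply 2 _ (I k)).comp continuous_entries

/-- The mutual moment of order `n` of two measures. -/
def mutualMoment (n : ℕ) (μ ν : Measure (Grassmannian 𝕜 1 d)) : ℝ :=
  RCLike.re (inner 𝕜 (∫ W, moment n W ∂μ) (∫ W, moment n W ∂ν))

theorem mutualMoment_comm (n : ℕ) (μ ν : Measure (Grassmannian 𝕜 1 d)) :
    mutualMoment n μ ν = mutualMoment n ν μ :=
  inner_re_symm _ _

variable [Nonempty (Grassmannian 𝕜 1 d)]

theorem re_inner_moment (n : ℕ) (X W : Grassmannian 𝕜 1 d) :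
    RCLike.re (inner 𝕜 (moment n X) (moment n W)) = overlap X W ^ n := by
  rw [inner_moment, inner_entries, ← RCLike.ofReal_pow, RCLike.ofReal_re]

theorem integrable_of_continuous {E : Type*} [NormedAddCommGroup E]
    {f : Grassmannian 𝕜 1 d → E} (hf : Continuous f)
    (μ : Measure (Grassmannian 𝕜 1 d)) [IsFiniteMeasure μ] : Integrable f μ :=
  hf.integrable_of_hasCompactSupport (HasCompactSupport.of_compactSpace f)

theorem conj_entries (W : Grassmannian 𝕜 1 d) (p : Fin d × Fin d) :
    starRingEnd 𝕜 (W.entries p) = W.entries p.swap := by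
  obtain ⟨x, hx, rfl⟩ := exists_line_eq W
  have hx0 : x ≠ 0 := by rintro rfl; simp at hx
  simp [entries_line hx0, hx, mul_comm]

/-- A Borel probability measure on the projective space is determined by its moments. -/
theorem ext_of_integral_moment {μ ν : Measure (Grassmannian 𝕜 1 d)} [IsFiniteMeasure μ]
    [IsFiniteMeasure ν] (h : ∀ n, ∫ W, moment n W ∂μ = ∫ W, moment n W ∂ν) : μ = ν := by
  let e : Fin d × Fin d → BoundedContinuousFunction (Grassmannian 𝕜 1 d) 𝕜 := fun p =>
    BoundedContinuousFunction.mkOfCompact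
      ⟨fun W => W.entries p, (PiLp.continuous_apply 2 _ p).comp continuous_entries⟩
  have hstar : ∀ p, star (e p) = e p.swap := fun p => by
    ext W
    exact conj_entries W p
  have hint : ∀ (n : ℕ) (I : Fin n → Fin d × Fin d) (ρ : Measure (Grassmannian 𝕜 1 d))
      [IsFiniteMeasure ρ], ∫ W, ∏ k, W.entries (I k) ∂ρ = (∫ W, moment n W ∂ρ) I := by
    intro n I ρ _
    exact (PiLp.proj 2 (fun _ : Fin n → Fin d × Fin d => 𝕜) I : _ →L[𝕜] 𝕜).integral_comp_comm
      (integrable_of_continuous (continuous_moment n) ρ)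
  -- Stone–Weierstrass: the entries separate lines, so it suffices to test on the star algebra they
  -- generate.
  refine ext_of_forall_mem_subalgebra_integral_eq_of_polish (𝕜 := 𝕜)
    (A := StarAlgebra.adjoin 𝕜 (Set.range e)) ?_ ?_
  · intro V W hVW
    have : V.entries ≠ W.entries := fun h => hVW (entries_isometry.injective h)
    obtain ⟨p, hp⟩ : ∃ p, V.entries p ≠ W.entries p := by
      by_contra! hc
      exact this (PiLp.ext hc)
    exact ⟨e p, ⟨_, ⟨e p, StarAlgebra.subset_adjoin 𝕜 _ ⟨p, rfl⟩, rfl⟩, rfl⟩, hp⟩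
  · intro g hg
    -- This algebra is spanned by monomials in the entries, since by `hstar` conjugation only
    -- permutes the generators; integrals of monomials are coordinates of the moments.
    have hg' : g ∈ Submodule.span 𝕜
        (Submonoid.closure (Set.range e ∪ star (Set.range e)) : Set _) := by
      rw [← StarAlgebra.adjoin_eq_span]; exact hg
    clear hg
    induction hg' using Submodule.span_induction with
    | mem f hf =>
      obtain ⟨l, hl⟩ : ∃ l : List (Fin d × Fin d), f = (l.map e).prod := by
        induction hf using Submonoid.closure_induction with
        | mem f hf =>
          rcases hf with ⟨p, rfl⟩ | ⟨p, hp⟩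
          · exact ⟨[p], by simp⟩
          · refine ⟨[p.swap], ?_⟩
            rw [← star_star f, ← hp, hstar]
            simp
        | one => exact ⟨[], rfl⟩
        | mul f₁ f₂ _ _ h₁ h₂ =>
          obtain ⟨l₁, rfl⟩ := h₁
          obtain ⟨l₂, rfl⟩ := h₂
          exact ⟨l₁ ++ l₂, by simp⟩
      have hf' : ∀ W, f W = ∏ k : Fin l.length, W.entries (l.get k) := fun W => by
        rw [hl]
        clear hl
        induction l with
        | nil => simp
        | cons p l ih =>
          rw [List.map_cons, List.prod_cons, BoundedContinuousFunction.mul_apply, ih]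
          exact (Fin.prod_univ_succ fun k : Fin (l.length + 1) => W.entries ((p :: l).get k)).symm
      simp only [hf', hint, h]
    | zero => simp
    | add f₁ f₂ _ _ i₁ i₂ =>
      simp only [BoundedContinuousFunction.add_apply]
      rw [integral_add (integrable_of_continuous f₁.continuous μ)
        (integrable_of_continuous f₂.continuous μ), i₁, i₂,
        integral_add (integrable_of_continuous f₁.continuous ν)
        (integrable_of_continuous f₂.continuous ν)]
    | smul c f _ i =>
      simp only [BoundedContinuousFunction.coe_smul]
      rw [integral_smul, integral_smul, i]

theorem integral_overlap_pow (n : ℕ) (μ : Measure (Grassmannian 𝕜 1 d)) [IsFiniteMeasure μ]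
    (X : Grassmannian 𝕜 1 d) :
    ∫ W, overlap X W ^ n ∂μ = RCLike.re (inner 𝕜 (moment n X) (∫ W, moment n W ∂μ)) := by
  rw [← integral_inner (integrable_of_continuous (continuous_moment n) μ), ← integral_re]
  · simp only [re_inner_moment]
  · exact integrable_of_continuous (continuous_const.inner (continuous_moment n)) μ

theorem continuous_integral_overlap_pow (n : ℕ) (μ : Measure (Grassmannian 𝕜 1 d))
    [IsFiniteMeasure μ] : Continuous fun X => ∫ W, overlap X W ^ n ∂μ := by
  simp only [integral_overlap_pow]
  exact RCLike.continuous_re.comp ((continuous_moment n).inner continuous_const)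

theorem integral_integral_overlap_pow (n : ℕ) (μ ν : Measure (Grassmannian 𝕜 1 d))
    [IsFiniteMeasure μ] [IsFiniteMeasure ν] :
    ∫ X, ∫ W, overlap X W ^ n ∂μ ∂ν = mutualMoment n μ ν := by
  have h : ∀ X : Grassmannian 𝕜 1 d, ∫ W, overlap X W ^ n ∂μ =
      RCLike.re (inner 𝕜 (∫ W, moment n W ∂μ) (moment n X)) := fun X => by
    rw [integral_overlap_pow, inner_re_symm]
  simp only [h]
  rw [integral_re, integral_inner (integrable_of_continuous (continuous_moment n) ν), mutualMoment]
  exact integrable_of_continuous (continuous_const.inner (continuous_moment n)) ν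

/-! ### Comparison with a measure of constant potentials -/

section Isotropic

variable {Γ μ : Measure (Grassmannian 𝕜 1 d)} [IsProbabilityMeasure μ]
  {γ : ℕ → ℝ}

theorem isotropic_nonneg (hΓ : ∀ n X, ∫ W, overlap X W ^ n ∂Γ = γ n) (n : ℕ) : 0 ≤ γ n := by
  rw [← hΓ n (Classical.arbitrary _)]
  exact integral_nonneg fun W => pow_nonneg (overlap_nonneg _ _) n

variable [IsProbabilityMeasure Γ]

theorem mutualMoment_isotropic (hΓ : ∀ n X, ∫ W, overlap X W ^ n ∂Γ = γ n) (n : ℕ)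
    (ρ : Measure (Grassmannian 𝕜 1 d)) [IsProbabilityMeasure ρ] : mutualMoment n Γ ρ = γ n := by
  simp [← integral_integral_overlap_pow, hΓ]

/-- Expanding the square, the cross terms and the energy of `Γ` all reduce to `γ n`, since the
potential of `Γ` is constant. -/
theorem norm_integral_moment_sub_sq (hΓ : ∀ n X, ∫ W, overlap X W ^ n ∂Γ = γ n) (n : ℕ) :
    ‖∫ W, moment n W ∂μ - ∫ W, moment n W ∂Γ‖ ^ 2 = mutualMoment n μ μ - γ n := by
  rw [norm_sub_sq (𝕜 := 𝕜), ← inner_self_eq_norm_sq (𝕜 := 𝕜) (∫ W, moment n W ∂Γ),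
    ← inner_self_eq_norm_sq (𝕜 := 𝕜) (∫ W, moment n W ∂μ)]
  have h1 := mutualMoment_isotropic hΓ n Γ
  have h2 := mutualMoment_isotropic hΓ n μ
  rw [mutualMoment_comm] at h2
  simp only [mutualMoment] at *
  rw [h1, h2]
  ring

theorem le_mutualMoment_self (hΓ : ∀ n X, ∫ W, overlap X W ^ n ∂Γ = γ n) (n : ℕ) :
    γ n ≤ mutualMoment n μ μ := by
  have := norm_integral_moment_sub_sq (μ := μ) hΓ n
  nlinarith [sq_nonneg ‖∫ W, moment n W ∂μ - ∫ W, moment n W ∂Γ‖]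

theorem eq_of_mutualMoment_self (hΓ : ∀ n X, ∫ W, overlap X W ^ n ∂Γ = γ n)
    (h : ∀ n, mutualMoment n μ μ = γ n) : μ = Γ := by
  refine ext_of_integral_moment fun n => ?_
  have := norm_integral_moment_sub_sq (μ := μ) hΓ n
  rw [h n, sub_self, sq_eq_zero_iff, norm_eq_zero, sub_eq_zero] at this
  exact this

theorem mutualMoment_zero : mutualMoment 0 μ μ = 1 := by
  simp [← integral_integral_overlap_pow]

theorem isotropic_zero (hΓ : ∀ n X, ∫ W, overlap X W ^ n ∂Γ = γ n) : γ 0 = 1 := by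
  simpa using (hΓ 0 (Classical.arbitrary _)).symm

/-- The potential of a measure for the kernel `∑ aₙ (tr (P_X P_W))ⁿ`. -/
def seriesPotential (a : ℕ → ENNReal) (μ : Measure (Grassmannian 𝕜 1 d))
    (X : Grassmannian 𝕜 1 d) : ENNReal :=
  ∑' n, a n * ENNReal.ofReal (∫ W, overlap X W ^ n ∂μ)

theorem lowerSemicontinuous_seriesPotential (a : ℕ → ENNReal) (ha : ∀ n, a n ≠ ⊤)
    (μ : Measure (Grassmannian 𝕜 1 d)) [IsFiniteMeasure μ] :
    LowerSemicontinuous (seriesPotential a μ) :=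
  lowerSemicontinuous_tsum fun n => Continuous.lowerSemicontinuous <|
    (ENNReal.continuous_const_mul (ha n)).comp
      (ENNReal.continuous_ofReal.comp (continuous_integral_overlap_pow n μ))

theorem lintegral_seriesPotential (a : ℕ → ENNReal) (μ ν : Measure (Grassmannian 𝕜 1 d))
    [IsFiniteMeasure μ] [IsFiniteMeasure ν] :
    ∫⁻ X, seriesPotential a μ X ∂ν = ∑' n, a n * ENNReal.ofReal (mutualMoment n μ ν) := by
  have hm : ∀ n, Measurable fun X => ENNReal.ofReal (∫ W, overlap X W ^ n ∂μ) := fun n =>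
    ENNReal.measurable_ofReal.comp (continuous_integral_overlap_pow n μ).measurable
  simp only [seriesPotential]
  rw [lintegral_tsum fun n => ((hm n).const_mul _).aemeasurable]
  refine tsum_congr fun n => ?_
  rw [lintegral_const_mul _ (hm n), ← integral_integral_overlap_pow,
    ofReal_integral_eq_lintegral_ofReal]
  · exact integrable_of_continuous (continuous_integral_overlap_pow n μ) ν
  · exact Filter.Eventually.of_forall fun X =>
      integral_nonneg fun W => pow_nonneg (overlap_nonneg _ _) n

/-- If the potential of `μ` is nowhere smaller than the constant potential of an isotropic measure
`Γ` of full support, then `μ = Γ`. -/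
theorem eq_of_le_seriesPotential [Γ.IsOpenPosMeasure]
    (hΓ : ∀ n X, ∫ W, overlap X W ^ n ∂Γ = γ n) {a : ℕ → ENNReal} (ha : ∀ n, a n ≠ ⊤)
    (ha0 : ∀ n ≠ 0, a n ≠ 0) (hC : ∑' n, a n * ENNReal.ofReal (γ n) ≠ ⊤)
    (h : ∀ X, ∑' n, a n * ENNReal.ofReal (γ n) ≤ seriesPotential a μ X) : μ = Γ := by
  set C := ∑' n, a n * ENNReal.ofReal (γ n) with hCdef
  have hlsc := lowerSemicontinuous_seriesPotential a ha μ
  have hmean : ∫⁻ X, seriesPotential a μ X ∂Γ = C := by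
    rw [lintegral_seriesPotential]
    simp only [mutualMoment_comm _ μ Γ, mutualMoment_isotropic hΓ, hCdef]
  -- A function bounded below by its own finite mean is almost everywhere equal to it.
  have hae : (fun _ => C) =ᵐ[Γ] seriesPotential a μ :=
    ae_eq_of_ae_le_of_lintegral_le (Filter.Eventually.of_forall h) (by simpa using hC)
      hlsc.measurable.aemeasurable (by simp [hmean])
  -- The sublevel set is closed by lower semicontinuity and dense by full support, so it is
  -- everything.
  have hle : ∀ X, seriesPotential a μ X ≤ C := by
    have hd : Dense {X | seriesPotential a μ X ≤ C} :=
      Γ.dense_of_ae (hae.mono fun X hX => hX.symm.le)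
    have hcl : IsClosed {X | seriesPotential a μ X ≤ C} := hlsc.isClosed_preimage C
    intro X
    exact (hcl.closure_eq ▸ hd X : X ∈ {X | seriesPotential a μ X ≤ C})
  have henergy : ∑' n, a n * ENNReal.ofReal (mutualMoment n μ μ) ≤ C := by
    rw [← lintegral_seriesPotential]
    exact (lintegral_mono hle).trans (by simp)
  refine eq_of_mutualMoment_self hΓ fun n => ?_
  -- The coefficient `a 0` may vanish, but order 0 only records the total mass.
  rcases eq_or_ne n 0 with rfl | hn
  · rw [mutualMoment_zero, isotropic_zero hΓ]
  refine le_antisymm ?_ (le_mutualMoment_self hΓ n)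
  -- One strict inequality among the termwise ones would make the energy exceed the finite `C`.
  by_contra! hlt
  refine henergy.not_gt (ENNReal.tsum_lt_tsum (i := n) hC (fun m => ?_) ?_)
  · gcongr
    exact le_mutualMoment_self hΓ m
  · refine ENNReal.mul_lt_mul_right (ha0 n hn) (ha n) ?_
    exact ENNReal.ofReal_lt_ofReal_iff_of_nonneg (isotropic_nonneg hΓ n) |>.2 hlt

end Isotropic

end Grassmannian

/-! ### Power series of the two kernels -/

/-- The sum of a power series with coefficients in `[0, ∞]`. -/
def ennrealSeries (a : ℕ → ENNReal) (t : ℝ) : ENNReal := ∑' n, a n * ENNReal.ofReal (t ^ n)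

theorem measurable_ennrealSeries (a : ℕ → ENNReal) : Measurable (ennrealSeries a) :=
  Measurable.tsum fun n => (ENNReal.measurable_ofReal.comp (measurable_id.pow_const n)).const_mul _

theorem lowerSemicontinuous_ennrealSeries {a : ℕ → ENNReal} (ha : ∀ n, a n ≠ ⊤) :
    LowerSemicontinuous (ennrealSeries a) :=
  lowerSemicontinuous_tsum fun n => Continuous.lowerSemicontinuous <|
    (ENNReal.continuous_const_mul (ha n)).comp (ENNReal.continuous_ofReal.comp (continuous_pow n))

theorem ennrealSeries_mono (a : ℕ → ENNReal) {t u : ℝ} (ht : 0 ≤ t) (htu : t ≤ u) :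
    ennrealSeries a t ≤ ennrealSeries a u := by
  unfold ennrealSeries
  gcongr

/-- A function that agrees with a power series on `[0, 1)` and is left continuous at `1` agrees with it
on `[0, 1]`. -/
theorem eq_ennrealSeries_of_continuousWithinAt {a : ℕ → ENNReal} (ha : ∀ n, a n ≠ ⊤)
    {g : ℝ → ENNReal} (hg : ContinuousWithinAt g (Set.Iio 1) 1)
    (h : ∀ t, 0 ≤ t → t < 1 → g t = ennrealSeries a t) {t : ℝ} (h0 : 0 ≤ t) (h1 : t ≤ 1) :
    g t = ennrealSeries a t := by
  rcases h1.lt_or_eq with h1 | rfl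
  · exact h t h0 h1
  have hev : ∀ᶠ t in nhdsWithin (1 : ℝ) (Set.Iio 1), 0 ≤ t ∧ t < 1 := by
    filter_upwards [Ico_mem_nhdsLT (zero_lt_one' ℝ)] with t ht using ht
  -- Abel's theorem for nonnegative coefficients, infinite sums included: lower semicontinuity
  -- bounds the limit below, monotonicity above.
  have hlim : Filter.Tendsto (ennrealSeries a) (nhdsWithin 1 (Set.Iio 1))
      (nhds (ennrealSeries a 1)) := by
    refine tendsto_order.2 ⟨fun y hy => ?_, fun y hy => ?_⟩
    · exact (lowerSemicontinuous_ennrealSeries ha 1 y hy).filter_mono nhdsWithin_le_nhds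
    · filter_upwards [hev] with t ht
      exact (ennrealSeries_mono a ht.1 ht.2.le).trans_lt hy
  refine tendsto_nhds_unique (hg.tendsto) (hlim.congr' ?_)
  filter_upwards [hev] with t ht
  exact (h t ht.1 ht.2).symm

theorem ennrealSeries_ofReal_of_hasSum {c : ℕ → ℝ} (hc : ∀ n, 0 ≤ c n) {t S : ℝ} (ht : 0 ≤ t)
    (h : HasSum (fun n => c n * t ^ n) S) :
    ennrealSeries (fun n => ENNReal.ofReal (c n)) t = ENNReal.ofReal S := by
  rw [← h.tsum_eq, ENNReal.ofReal_tsum_of_nonneg (fun n => by have := hc n; positivity) h.summable]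
  exact tsum_congr fun n => (ENNReal.ofReal_mul (hc n)).symm

/-- In `s (s - 1) ⋯ (s - n)` every factor but the first is negative. -/
theorem Ring.choose_mul_neg_one_pow_pos {s : ℝ} (h0 : 0 < s) (h1 : s < 1) (n : ℕ) :
    0 < (-1) ^ n * Ring.choose s (n + 1) := by
  have key : 0 < (-1) ^ n * (descPochhammer ℤ (n + 1)).smeval s := by
    induction n with
    | zero => simpa using h0
    | succ n ih =>
      have hs : (descPochhammer ℤ (n + 1 + 1)).smeval s =
          (descPochhammer ℤ (n + 1)).smeval s * (s - (n + 1)) := by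
        rw [descPochhammer_succ_right]
        simp [Polynomial.smeval_mul, Polynomial.smeval_natCast]
      have hn : (0 : ℝ) < n + 1 - s := by
        have : (0 : ℝ) ≤ n := n.cast_nonneg
        linarith
      have := mul_pos ih hn
      rw [hs, pow_succ]
      linarith
  rw [Ring.descPochhammer_eq_factorial_smul_choose, nsmul_eq_mul, mul_left_comm] at key
  exact (mul_pos_iff_of_pos_left (by positivity)).1 key

/-- The Taylor coefficients of `1 - (1 - t)^s`. -/
def powerCoeff (s : ℝ) : ℕ → ℝ
  | 0 => 0
  | n + 1 => (-1) ^ n * Ring.choose s (n + 1)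

theorem hasSum_powerCoeff (s : ℝ) {t : ℝ} (h0 : 0 ≤ t) (h1 : t < 1) :
    HasSum (fun n => powerCoeff s n * t ^ n) (1 - (1 - t) ^ s) := by
  have h := (Real.one_add_rpow_hasFPowerSeriesOnBall_zero (a := s)).hasSum (y := -t)
    (by simpa [abs_of_nonneg h0, ← ENNReal.ofReal_one, Metric.eball_ofReal] using h1)
  simp only [binomialSeries_apply, List.ofFn_const, List.prod_replicate, smul_eq_mul,
    zero_add] at h
  rw [← sub_eq_add_neg] at h
  rw [← hasSum_nat_add_iff' 1] at h ⊢
  simp only [Finset.range_one, Finset.sum_singleton, Ring.choose_zero_right, pow_zero, mul_one,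
    powerCoeff, sub_zero] at h ⊢
  convert h.neg using 1
  · ext n
    rw [neg_pow t]
    ring
  · ring

theorem ennrealSeries_powerCoeff {s : ℝ} (hs0 : 0 < s) (hs1 : s < 1) {t : ℝ} (h0 : 0 ≤ t)
    (h1 : t ≤ 1) : ENNReal.ofReal (1 - (1 - t) ^ s) =
      ennrealSeries (fun n => ENNReal.ofReal (powerCoeff s n)) t := by
  refine eq_ennrealSeries_of_continuousWithinAt (g := fun t => ENNReal.ofReal (1 - (1 - t) ^ s))
    (fun n => ENNReal.ofReal_ne_top) ?_ (fun t h0 h1 => ?_) h0 h1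
  · refine Continuous.continuousWithinAt (ENNReal.continuous_ofReal.comp ?_)
    exact continuous_const.sub ((continuous_const.sub continuous_id).rpow_const
      fun _ => Or.inr hs0.le)
  · refine (ennrealSeries_ofReal_of_hasSum (fun n => ?_) h0 (hasSum_powerCoeff s h0 h1)).symm
    cases n with
    | zero => exact le_rfl
    | succ n => exact (Ring.choose_mul_neg_one_pow_pos hs0 hs1 n).le

theorem ennrealSeries_inv_of_lt {t : ℝ} (h0 : 0 ≤ t) (h1 : t < 1) :
    ennrealSeries (fun n => ENNReal.ofReal (n : ℝ)⁻¹) t = ENNReal.ofReal (-Real.log (1 - t)) := by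
  refine ennrealSeries_ofReal_of_hasSum (fun n => by positivity) h0 ?_
  -- The term of order 0 vanishes because `(0 : ℝ)⁻¹ = 0`.
  rw [← hasSum_nat_add_iff' 1]
  have h := Real.hasSum_pow_div_log_of_abs_lt_one (x := t) (by rwa [abs_of_nonneg h0])
  simpa [div_eq_inv_mul] using h

theorem ennrealSeries_inv {t : ℝ} (h0 : 0 ≤ t) (h1 : t ≤ 1) :
    (-ENNReal.log (ENNReal.ofReal (1 - t))).toENNReal =
      ennrealSeries (fun n => ENNReal.ofReal (n : ℝ)⁻¹) t := by
  refine eq_ennrealSeries_of_continuousWithinAt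
    (g := fun t => (-ENNReal.log (ENNReal.ofReal (1 - t))).toENNReal)
    (fun n => ENNReal.ofReal_ne_top) ?_ (fun t h0 h1 => ?_) h0 h1
  · refine Continuous.continuousWithinAt (EReal.continuous_toENNReal.comp ?_)
    exact continuous_neg.comp (ENNReal.continuous_log.comp
      (ENNReal.continuous_ofReal.comp (continuous_const.sub continuous_id)))
  · rw [ennrealSeries_inv_of_lt h0 h1, ENNReal.log_ofReal_of_pos (by linarith), ← EReal.coe_neg,
      EReal.toENNReal_of_ne_top (EReal.coe_ne_top _), EReal.toReal_coe]

/-! ### Constant potentials and finiteness of the logarithmic one -/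

namespace Grassmannian

variable {𝕜 : Type*} [RCLike 𝕜] {d : ℕ}

/-- The point of angle `θ` of a great semicircle, parametrised with double speed. -/
def circlePoint (i j : Fin d) (θ : ℝ) : Hd 𝕜 d :=
  EuclideanSpace.single i (Real.cos (θ / 2) : 𝕜) + EuclideanSpace.single j (Real.sin (θ / 2) : 𝕜)

theorem norm_circlePoint {i j : Fin d} (hij : i ≠ j) (θ : ℝ) :
    ‖(circlePoint i j θ : Hd 𝕜 d)‖ = 1 := by
  have h : ‖(circlePoint i j θ : Hd 𝕜 d)‖ ^ 2 = 1 := by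
    rw [circlePoint, norm_add_sq (𝕜 := 𝕜), PiLp.norm_single, PiLp.norm_single,
      EuclideanSpace.inner_single_right]
    simp [hij.symm]
  nlinarith [norm_nonneg (circlePoint i j θ : Hd 𝕜 d)]

theorem _root_.Continuous.overlap {Y : Type*} [TopologicalSpace Y] {f g : Y → Grassmannian 𝕜 1 d}
    (hf : Continuous f) (hg : Continuous g) : Continuous fun y => overlap (f y) (g y) :=
  RCLike.continuous_re.comp ((continuous_entries.comp hf).inner (continuous_entries.comp hg))

variable [Nonempty (Grassmannian 𝕜 1 d)]

theorem lintegral_ennrealSeries (a : ℕ → ENNReal) (μ : Measure (Grassmannian 𝕜 1 d))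
    [IsFiniteMeasure μ] (X : Grassmannian 𝕜 1 d) :
    ∫⁻ W, ennrealSeries a (overlap X W) ∂μ = seriesPotential a μ X := by
  have hc : Continuous fun W : Grassmannian 𝕜 1 d => overlap X W :=
    continuous_const.overlap continuous_id
  have hm : ∀ n, Measurable fun W : Grassmannian 𝕜 1 d => ENNReal.ofReal (overlap X W ^ n) :=
    fun n => ENNReal.measurable_ofReal.comp (hc.pow n).measurable
  simp only [ennrealSeries, seriesPotential]
  rw [lintegral_tsum fun n => ((hm n).const_mul _).aemeasurable]
  refine tsum_congr fun n => ?_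
  rw [lintegral_const_mul _ (hm n), ofReal_integral_eq_lintegral_ofReal]
  · exact integrable_of_continuous (hc.pow n) μ
  · exact Filter.Eventually.of_forall fun W => pow_nonneg (overlap_nonneg _ _) n

theorem exists_integral_overlap_pow_eq {μ : Measure (Grassmannian 𝕜 1 d)}
    (hμ : ∀ g : Hd 𝕜 d ≃ₗᵢ[𝕜] Hd 𝕜 d, μ.map (image g) = μ) :
    ∃ γ : ℕ → ℝ, ∀ n X, ∫ W, overlap X W ^ n ∂μ = γ n := by
  refine ⟨fun n => ∫ W, overlap (Classical.arbitrary _) W ^ n ∂μ, fun n X => ?_⟩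
  obtain ⟨g, hg⟩ := exists_image_eq X (Classical.arbitrary (Grassmannian 𝕜 1 d))
  have hc : Continuous fun W : Grassmannian 𝕜 1 d => overlap (image g X) W ^ n :=
    (continuous_const.overlap continuous_id).pow n
  beta_reduce
  rw [← hg]
  conv_rhs => rw [← hμ g]
  rw [integral_map (continuous_image g).aemeasurable hc.aestronglyMeasurable]
  simp only [overlap_image]

/-- With `u = (c² - s², 2sc)` and `v = (A - D, 2B)`, `|u| = 1` and `|v| ≤ A + D ≤ 1`. The right side
is `4 - 2(A + D) - 2 u·v`, at least `2 - 2 u·v`, while the left side `|u - v|²` is at most that. -/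
theorem circle_quadratic_bound {A D B c s : ℝ} (hA : 0 ≤ A) (hD : 0 ≤ D) (hAD : A + D ≤ 1)
    (hB : B ^ 2 ≤ A * D) (hcs : c ^ 2 + s ^ 2 = 1) :
    (c ^ 2 - s ^ 2 - (A - D)) ^ 2 + (2 * s * c - 2 * B) ^ 2 ≤
      4 * (1 - (c ^ 2 * A + s ^ 2 * D + 2 * c * s * B)) := by
  have h1 : (c ^ 2 - s ^ 2) ^ 2 + (2 * s * c) ^ 2 = 1 := by
    have : (c ^ 2 - s ^ 2) ^ 2 + (2 * s * c) ^ 2 = (c ^ 2 + s ^ 2) ^ 2 := by ring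
    rw [this, hcs, one_pow]
  have hs : s ^ 2 = 1 - c ^ 2 := by linarith
  have h2 : (A + D) ^ 2 ≤ 1 := pow_le_one₀ (by linarith) hAD
  have h3 : c ^ 2 * A + s ^ 2 * D = ((A + D) + (c ^ 2 - s ^ 2) * (A - D)) / 2 := by
    rw [hs]; ring
  rw [h3]
  nlinarith

/-- Along a great semicircle, `1 - tr (P_X P_W)` dominates a squared distance on the unit circle. -/
theorem exists_norm_circleMap_sub_sq_le {i j : Fin d} (hij : i ≠ j) (W : Grassmannian 𝕜 1 d) :
    ∃ a : ℂ, ‖a‖ ≤ 1 ∧ ∀ θ : ℝ,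
      ‖circleMap 0 1 θ - a‖ ^ 2 ≤ 4 * (1 - overlap (line (circlePoint i j θ)) W) := by
  obtain ⟨w, hw, rfl⟩ := exists_line_eq W
  have hw0 : w ≠ 0 := by rintro rfl; simp at hw
  set p := w i
  set r := w j
  have hsum : ‖p‖ ^ 2 + ‖r‖ ^ 2 ≤ 1 := by
    have h := EuclideanSpace.norm_sq_eq w
    rw [hw, one_pow] at h
    rw [h, ← Finset.sum_pair (f := fun k => ‖w k‖ ^ 2) hij]
    exact Finset.sum_le_sum_of_subset_of_nonneg (Finset.subset_univ _) fun _ _ _ => by positivity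
  have hp := RCLike.norm_sq_eq_def (z := p)
  have hr := RCLike.norm_sq_eq_def (z := r)
  set B := RCLike.re p * RCLike.re r + RCLike.im p * RCLike.im r
  have hB : B ^ 2 ≤ ‖p‖ ^ 2 * ‖r‖ ^ 2 := by
    rw [hp, hr]
    nlinarith [sq_nonneg (RCLike.re p * RCLike.im r - RCLike.im p * RCLike.re r)]
  -- The overlap is quadratic in `cos (θ/2)` and `sin (θ/2)`, hence affine in `(cos θ, sin θ)`; `a`
  -- is twice its linear part.
  refine ⟨⟨‖p‖ ^ 2 - ‖r‖ ^ 2, 2 * B⟩, ?_, fun θ => ?_⟩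
  · rw [← sq_le_one_iff₀ (norm_nonneg _), Complex.sq_norm, Complex.normSq_apply]
    nlinarith [sq_nonneg ‖p‖, sq_nonneg ‖r‖, pow_le_one₀ (n := 2) (by positivity) hsum]
  have hov : overlap (line (circlePoint i j θ)) (line w) =
      Real.cos (θ / 2) ^ 2 * ‖p‖ ^ 2 + Real.sin (θ / 2) ^ 2 * ‖r‖ ^ 2 +
        2 * Real.cos (θ / 2) * Real.sin (θ / 2) * B := by
    rw [overlap_line (norm_circlePoint hij θ), line_proj hw0, norm_smul, hw, circlePoint,
      inner_add_right, EuclideanSpace.inner_single_right, EuclideanSpace.inner_single_right]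
    simp only [one_pow, RCLike.ofReal_one, div_one, mul_one]
    rw [RCLike.norm_sq_eq_def, hp, hr]
    simp only [map_add, RCLike.re_ofReal_mul, RCLike.im_ofReal_mul, RCLike.conj_re, RCLike.conj_im]
    simp only [B, p, r]
    ring
  rw [hov]
  refine le_trans (le_of_eq ?_) (circle_quadratic_bound (sq_nonneg ‖p‖) (sq_nonneg ‖r‖) hsum hB
    (Real.cos_sq_add_sin_sq (θ / 2)))
  have hθ : θ = 2 * (θ / 2) := by ring
  rw [Complex.sq_norm, Complex.normSq_apply]
  have h1 : (circleMap 0 1 θ).re = Real.cos (θ / 2) ^ 2 - Real.sin (θ / 2) ^ 2 := by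
    rw [← Real.cos_two_mul', ← hθ]; simp [circleMap, Complex.exp_ofReal_mul_I_re]
  have h2 : (circleMap 0 1 θ).im = 2 * Real.sin (θ / 2) * Real.cos (θ / 2) := by
    rw [← Real.sin_two_mul, ← hθ]; simp [circleMap, Complex.exp_ofReal_mul_I_im]
  rw [Complex.sub_re, Complex.sub_im, h1, h2]
  ring

/-- The kernel is at most `log 4 - 2 log |z - a|` on the unit circle, and `log |z - a|` has mean
zero there since `|a| ≤ 1`. The bound does not depend on `W`. -/
theorem lintegral_circle_ennrealSeries_inv_le {i j : Fin d} (hij : i ≠ j)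
    (W : Grassmannian 𝕜 1 d) :
    ∫⁻ θ in Set.Ioc 0 (2 * Real.pi), ennrealSeries (fun n => ENNReal.ofReal (n : ℝ)⁻¹)
      (overlap (line (circlePoint i j θ)) W) ≤ ENNReal.ofReal (2 * Real.pi * Real.log 4) := by
  obtain ⟨a, ha, hle⟩ := exists_norm_circleMap_sub_sq_le hij W
  have hpi : (0 : ℝ) ≤ 2 * Real.pi := by positivity
  have hci : IntervalIntegrable (fun θ => Real.log ‖circleMap 0 1 θ - a‖) volume 0 (2 * Real.pi) :=
    circleIntegrable_log_norm_sub_const (a := a) (c := 0) 1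
  have hav : ∫ θ in (0 : ℝ)..2 * Real.pi, Real.log ‖circleMap 0 1 θ - a‖ = 0 := by
    have := circleAverage_log_norm_sub_const_of_mem_closedBall (a := a) (c := 0) (R := 1)
      (by simpa using ha)
    rw [Real.circleAverage, Real.log_one, smul_eq_zero] at this
    exact this.resolve_left (by positivity)
  set h : ℝ → ℝ := fun θ => Real.log 4 - 2 * Real.log ‖circleMap 0 1 θ - a‖
  have hi : IntervalIntegrable h volume 0 (2 * Real.pi) :=
    intervalIntegrable_const.sub (hci.const_mul 2)
  have hint : ∫ θ in Set.Ioc 0 (2 * Real.pi), h θ = 2 * Real.pi * Real.log 4 := by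
    rw [← intervalIntegral.integral_of_le hpi,
      intervalIntegral.integral_sub intervalIntegrable_const (hci.const_mul 2),
      intervalIntegral.integral_const_mul, hav]
    simp
  have hne : ∀ᵐ θ : ℝ ∂volume.restrict (Set.Ioc 0 (2 * Real.pi)), circleMap 0 1 θ ≠ a := by
    refine ae_restrict_of_ae ?_
    have := ((Set.countable_singleton a).preimage_circleMap 0 one_ne_zero).ae_notMem volume
    exact this
  have hlog : ∀ θ, circleMap 0 1 θ ≠ a →
      -Real.log (1 - overlap (line (circlePoint i j θ)) W) ≤ h θ := by
    intro θ hθ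
    have hpos : 0 < ‖circleMap 0 1 θ - a‖ := norm_pos_iff.2 (sub_ne_zero.2 hθ)
    have h1 := Real.log_le_log (by positivity) (hle θ)
    have h2 : 0 < 1 - overlap (line (circlePoint i j θ)) W := by
      have := (pow_pos hpos 2).trans_le (hle θ)
      linarith
    rw [Real.log_pow, Real.log_mul (by norm_num) h2.ne'] at h1
    push_cast at h1
    simp only [h]
    linarith
  have hnn : ∀ θ, circleMap 0 1 θ ≠ a → 0 ≤ h θ := fun θ hθ => by
    refine le_trans ?_ (hlog θ hθ)
    rw [Left.nonneg_neg_iff]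
    exact Real.log_nonpos (sub_nonneg.2 (overlap_le_one _ _))
      (by linarith [overlap_nonneg (line (circlePoint i j θ)) W])
  rw [← hint, ofReal_integral_eq_lintegral_ofReal
    ((intervalIntegrable_iff_integrableOn_Ioc_of_le hpi).1 hi) (hne.mono hnn)]
  refine lintegral_mono_ae (hne.mono fun θ hθ => ?_)
  rw [ennrealSeries_inv_of_lt (overlap_nonneg _ _)]
  · exact ENNReal.ofReal_le_ofReal (hlog θ hθ)
  · have hpos : 0 < ‖circleMap 0 1 θ - a‖ := norm_pos_iff.2 (sub_ne_zero.2 hθ)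
    have := (pow_pos hpos 2).trans_le (hle θ)
    linarith

theorem continuous_line_circlePoint {i j : Fin d} (hij : i ≠ j) :
    Continuous fun θ : ℝ => (line (circlePoint i j θ) : Grassmannian 𝕜 1 d) := by
  refine continuousOn_line.comp_continuous ?_ fun θ => ?_
  · unfold circlePoint
    have hs : ∀ k : Fin d, Continuous fun z : 𝕜 => (EuclideanSpace.single k z : Hd 𝕜 d) := by
      intro k
      exact (PiLp.continuous_toLp 2 _).comp
        (continuous_single (A := fun _ : Fin d => 𝕜) k)
    exact ((hs i).comp (RCLike.continuous_ofReal.comp (Real.continuous_cos.comp (by fun_prop)))).add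
      ((hs j).comp (RCLike.continuous_ofReal.comp (Real.continuous_sin.comp (by fun_prop))))
  · intro h0
    have := norm_circlePoint (𝕜 := 𝕜) hij θ
    rw [Set.mem_singleton_iff.1 h0, norm_zero] at this
    exact zero_ne_one this

/-- An isotropic measure has finite logarithmic potential. -/
theorem tsum_inv_isotropic_ne_top (hd : 1 < d) {Γ : Measure (Grassmannian 𝕜 1 d)}
    [IsProbabilityMeasure Γ] {γ : ℕ → ℝ} (hΓ : ∀ n X, ∫ W, overlap X W ^ n ∂Γ = γ n) :
    ∑' n : ℕ, ENNReal.ofReal (n : ℝ)⁻¹ * ENNReal.ofReal (γ n) ≠ ⊤ := by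
  have hij : (⟨0, by omega⟩ : Fin d) ≠ ⟨1, hd⟩ := by simp
  set C := ∑' n : ℕ, ENNReal.ofReal (n : ℝ)⁻¹ * ENNReal.ofReal (γ n) with hC
  set ν : Measure ℝ := volume.restrict (Set.Ioc 0 (2 * Real.pi))
  set G := ennrealSeries fun n : ℕ => ENNReal.ofReal (n : ℝ)⁻¹
  have hpot : ∀ X : Grassmannian 𝕜 1 d, ∫⁻ W, G (overlap X W) ∂Γ = C := fun X => by
    simp only [G, lintegral_ennrealSeries, seriesPotential, hΓ, hC]
  have hm : Measurable fun q : ℝ × Grassmannian 𝕜 1 d =>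
      G (overlap (line (circlePoint ⟨0, by omega⟩ ⟨1, hd⟩ q.1)) q.2) := by
    refine (measurable_ennrealSeries _).comp (Continuous.measurable ?_)
    exact ((continuous_line_circlePoint hij).comp continuous_fst).overlap continuous_snd
  -- The potential of `Γ` is the constant `C`, so averaging it over a semicircle and exchanging
  -- integrals bounds `C`.
  have hswap := lintegral_lintegral_swap (μ := ν) (ν := Γ) (f := fun θ W =>
    G (overlap (line (circlePoint ⟨0, by omega⟩ ⟨1, hd⟩ θ)) W)) hm.aemeasurable
  simp only [hpot] at hswap
  have hle : ∫⁻ _, C ∂ν ≤ ENNReal.ofReal (2 * Real.pi * Real.log 4) := by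
    rw [hswap]
    exact (lintegral_mono fun W => lintegral_circle_ennrealSeries_inv_le hij W).trans (by simp)
  rintro htop
  rw [htop, lintegral_const, ENNReal.top_mul] at hle
  · simp at hle
  · simp [ν, Real.pi_pos]

end Grassmannian

/-! ### Uniqueness for invariance and for the two functionals -/

namespace Grassmannian

variable {𝕜 : Type*} [RCLike 𝕜] {d : ℕ}

theorem nonempty_of_pos (hd : 0 < d) : Nonempty (Grassmannian 𝕜 1 d) :=
  ⟨⟨𝕜 ∙ (EuclideanSpace.single ⟨0, hd⟩ 1 : Hd 𝕜 d), finrank_span_singleton (by simp)⟩⟩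

variable [Nonempty (Grassmannian 𝕜 1 d)]

/-- The mutual moment of `Γ` and `μ` can be computed from either potential, so `γ = γ'`. -/
theorem eq_of_isotropic {Γ μ : Measure (Grassmannian 𝕜 1 d)} [IsProbabilityMeasure Γ]
    [IsProbabilityMeasure μ] {γ γ' : ℕ → ℝ} (hΓ : ∀ n X, ∫ W, overlap X W ^ n ∂Γ = γ n)
    (hμ : ∀ n X, ∫ W, overlap X W ^ n ∂μ = γ' n) : μ = Γ := by
  refine eq_of_mutualMoment_self hΓ fun n => ?_
  rw [mutualMoment_isotropic hμ, ← mutualMoment_isotropic hμ n Γ, mutualMoment_comm,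
    mutualMoment_isotropic hΓ]

theorem integral_one_sub_overlap_rpow_le_one {s : ℝ} (hs : 0 < s)
    (μ : Measure (Grassmannian 𝕜 1 d)) [IsProbabilityMeasure μ] (X : Grassmannian 𝕜 1 d) :
    ∫ W, (1 - overlap X W) ^ s ∂μ ≤ 1 := by
  have h : ∀ W, ‖(1 - overlap X W) ^ s‖ ≤ 1 := fun W => by
    have h0 : 0 ≤ 1 - overlap X W := sub_nonneg.2 (overlap_le_one X W)
    rw [Real.norm_of_nonneg (Real.rpow_nonneg h0 s)]
    exact Real.rpow_le_one h0 (by linarith [overlap_nonneg X W]) hs.le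
  simpa using (le_abs_self _).trans
    (norm_integral_le_of_norm_le_const (μ := μ) (Filter.Eventually.of_forall h))

theorem seriesPotential_powerCoeff {s : ℝ} (hs0 : 0 < s) (hs1 : s < 1)
    (μ : Measure (Grassmannian 𝕜 1 d)) [IsProbabilityMeasure μ] (X : Grassmannian 𝕜 1 d) :
    seriesPotential (fun n => ENNReal.ofReal (powerCoeff s n)) μ X =
      ENNReal.ofReal (1 - ∫ W, (1 - overlap X W) ^ s ∂μ) := by
  have hc : Continuous fun W : Grassmannian 𝕜 1 d => (1 - overlap X W) ^ s :=
    (continuous_const.sub (continuous_const.overlap continuous_id)).rpow_const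
      fun _ => Or.inr hs0.le
  rw [← lintegral_ennrealSeries]
  simp only [← ennrealSeries_powerCoeff hs0 hs1 (overlap_nonneg X _) (overlap_le_one X _)]
  rw [← ofReal_integral_eq_lintegral_ofReal, integral_sub (integrable_const _)
    (integrable_of_continuous hc μ)]
  · simp
  · exact integrable_of_continuous (continuous_const.sub hc) μ
  · refine Filter.Eventually.of_forall fun W => sub_nonneg.2 ?_
    exact Real.rpow_le_one (sub_nonneg.2 (overlap_le_one X W))
      (by linarith [overlap_nonneg X W]) hs0.le

/-- The kernel is nonpositive, so only the negative part contributes, possibly with value `∞`. -/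
theorem erealIntegral_logKernel {x : Hd 𝕜 d} (hx : ‖x‖ = 1) (μ : Measure (Grassmannian 𝕜 1 d))
    [IsProbabilityMeasure μ] :
    erealIntegral (fun W : Grassmannian 𝕜 1 d => logKernel x W) μ =
      -(seriesPotential (fun n => ENNReal.ofReal (n : ℝ)⁻¹) μ (line x) : EReal) := by
  have hpos : ∀ W : Grassmannian 𝕜 1 d, (logKernel x W).toENNReal = 0 := fun W => by
    rw [EReal.toENNReal_eq_zero_iff, logKernel, ENNReal.log_le_zero_iff, ← ENNReal.ofReal_one]
    exact ENNReal.ofReal_le_ofReal (by linarith [sq_nonneg ‖W.proj x‖])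
  have hneg : ∀ W : Grassmannian 𝕜 1 d, (-logKernel x W).toENNReal =
      ennrealSeries (fun n => ENNReal.ofReal (n : ℝ)⁻¹) (overlap (line x) W) := fun W => by
    rw [← ennrealSeries_inv (overlap_nonneg _ _) (overlap_le_one _ _), overlap_line hx, logKernel]
  simp only [erealIntegral, hpos, hneg, lintegral_ennrealSeries]
  simp

theorem kaczmarzFunctional_line (s : ℝ) (μ : ProbabilityMeasure (Grassmannian 𝕜 1 d)) :
    kaczmarzFunctional s μ = ⨆ x : Metric.sphere (0 : Hd 𝕜 d) 1,
      ∫ W, (1 - overlap (line (x : Hd 𝕜 d)) W) ^ s ∂(μ : Measure (Grassmannian 𝕜 1 d)) := by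
  unfold kaczmarzFunctional
  congr! 5 with x W
  rw [overlap_line (by simp)]

theorem nonempty_sphere : Nonempty (Metric.sphere (0 : Hd 𝕜 d) 1) := by
  obtain ⟨x, hx, -⟩ := exists_line_eq (Classical.arbitrary (Grassmannian 𝕜 1 d))
  exact ⟨⟨x, by simpa using hx⟩⟩

theorem eq_of_kaczmarzFunctional_le {s : ℝ} (hs0 : 0 < s) (hs1 : s < 1)
    {Γ μ : ProbabilityMeasure (Grassmannian 𝕜 1 d)}
    [(Γ : Measure (Grassmannian 𝕜 1 d)).IsOpenPosMeasure] {γ : ℕ → ℝ}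
    (hΓ : ∀ n X, ∫ W, overlap X W ^ n ∂(Γ : Measure (Grassmannian 𝕜 1 d)) = γ n)
    (h : kaczmarzFunctional s μ ≤ kaczmarzFunctional s Γ) : μ = Γ := by
  have := nonempty_sphere (𝕜 := 𝕜) (d := d)
  have hconst : ∀ X : Grassmannian 𝕜 1 d,
      ENNReal.ofReal (1 - ∫ W, (1 - overlap X W) ^ s ∂(Γ : Measure (Grassmannian 𝕜 1 d))) =
        ∑' n, ENNReal.ofReal (powerCoeff s n) * ENNReal.ofReal (γ n) := fun X => by
    simp only [← seriesPotential_powerCoeff hs0 hs1, seriesPotential, hΓ]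
  have heq : ∀ X Y : Grassmannian 𝕜 1 d,
      ∫ W, (1 - overlap X W) ^ s ∂(Γ : Measure (Grassmannian 𝕜 1 d)) =
        ∫ W, (1 - overlap Y W) ^ s ∂(Γ : Measure (Grassmannian 𝕜 1 d)) := fun X Y => by
    have h1 := (ENNReal.ofReal_eq_ofReal_iff
      (sub_nonneg.2 (integral_one_sub_overlap_rpow_le_one hs0 _ X))
      (sub_nonneg.2 (integral_one_sub_overlap_rpow_le_one hs0 _ Y))).1
      ((hconst X).trans (hconst Y).symm)
    linarith
  refine ProbabilityMeasure.toMeasure_injective (eq_of_le_seriesPotential (a := fun n => ENNReal.ofReal (powerCoeff s n)) hΓ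
    (fun n => ENNReal.ofReal_ne_top) (fun n hn => ?_) ?_ fun X => ?_)
  · obtain ⟨m, rfl⟩ := Nat.exists_eq_succ_of_ne_zero hn
    exact (ENNReal.ofReal_pos.2 (Ring.choose_mul_neg_one_pow_pos hs0 hs1 m)).ne'
  · rw [← hconst (Classical.arbitrary _)]
    exact ENNReal.ofReal_ne_top
  · rw [← hconst X, seriesPotential_powerCoeff hs0 hs1]
    refine ENNReal.ofReal_le_ofReal (sub_le_sub_left ?_ 1)
    obtain ⟨x, hx, rfl⟩ := exists_line_eq X
    rw [kaczmarzFunctional_line, kaczmarzFunctional_line] at h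
    -- A real supremum dominates its terms only when the family is bounded above.
    have hbdd : BddAbove (Set.range fun y : Metric.sphere (0 : Hd 𝕜 d) 1 =>
        ∫ W, (1 - overlap (line (y : Hd 𝕜 d)) W) ^ s ∂(μ : Measure (Grassmannian 𝕜 1 d))) :=
      ⟨1, by rintro _ ⟨y, rfl⟩; exact integral_one_sub_overlap_rpow_le_one hs0 _ _⟩
    exact (le_ciSup hbdd ⟨x, by simpa using hx⟩).trans
      (h.trans (ciSup_le fun y => (heq _ _).le))

theorem eq_of_logKaczmarzFunctional_le (hd : 1 < d)
    {Γ μ : ProbabilityMeasure (Grassmannian 𝕜 1 d)}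
    [(Γ : Measure (Grassmannian 𝕜 1 d)).IsOpenPosMeasure] {γ : ℕ → ℝ}
    (hΓ : ∀ n X, ∫ W, overlap X W ^ n ∂(Γ : Measure (Grassmannian 𝕜 1 d)) = γ n)
    (h : logKaczmarzFunctional μ ≤ logKaczmarzFunctional Γ) : μ = Γ := by
  refine ProbabilityMeasure.toMeasure_injective (eq_of_le_seriesPotential (a := fun n => ENNReal.ofReal (n : ℝ)⁻¹) hΓ
    (fun n => ENNReal.ofReal_ne_top) (fun n hn => ?_) (tsum_inv_isotropic_ne_top hd hΓ)
    fun X => ?_)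
  · simp only [ne_eq, ENNReal.ofReal_eq_zero, not_le]
    positivity
  · obtain ⟨x, hx, rfl⟩ := exists_line_eq X
    have h1 : -(seriesPotential (fun n => ENNReal.ofReal (n : ℝ)⁻¹) μ (line x) : EReal) ≤
        logKaczmarzFunctional μ := by
      rw [← erealIntegral_logKernel hx]
      exact le_iSup (fun y : Metric.sphere (0 : Hd 𝕜 d) 1 => erealIntegral
        (fun W : Grassmannian 𝕜 1 d => logKernel (y : Hd 𝕜 d) W) (μ : Measure _))
        ⟨x, by simpa using hx⟩
    have h2 : logKaczmarzFunctional Γ ≤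
        -((∑' n : ℕ, ENNReal.ofReal (n : ℝ)⁻¹ * ENNReal.ofReal (γ n) : ENNReal) : EReal) := by
      refine iSup_le fun y => ?_
      rw [erealIntegral_logKernel (by simp)]
      simp only [seriesPotential, hΓ, le_refl]
    exact EReal.coe_ennreal_le_coe_ennreal_iff.1 (EReal.neg_le_neg_iff.1 ((h1.trans h).trans h2))

end Grassmannian

/-- The hypothesis also makes `a` a minimizer: by totality, any value not above `f a` is attained
only at `a`. -/
theorem isMinOn_univ_iff_eq_of_le_imp_eq {α β : Type*} [LinearOrder β] {f : α → β} {a : α}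
    (h : ∀ b, f b ≤ f a → b = a) (b : α) : IsMinOn f Set.univ b ↔ b = a := by
  rw [isMinOn_univ_iff]
  refine ⟨fun hb => h b (hb a), ?_⟩
  rintro rfl c
  rcases le_total (f b) (f c) with hc | hc
  · exact hc
  · exact (congrArg f (h c hc)).ge

end
/-- For `𝕜 = ℝ` or `ℂ` and `d ≥ 2` there is exactly one invariant Borel probability measure `Γ` on
`G(1, d)`, it is the unique minimizer of the order-`s` Kaczmarz functional whenever `0 < s < 1`,
and it is the unique minimizer of the logarithmic Kaczmarz functional. -/
theorem theorem5p1 (𝕜 : Type*) [RCLike 𝕜] (d : ℕ) (hd : 1 < d) :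
    ∃ Γ : ProbabilityMeasure (Grassmannian 𝕜 1 d),
      (∀ μ : ProbabilityMeasure (Grassmannian 𝕜 1 d), Grassmannian.IsInvariant μ ↔ μ = Γ) ∧
      (∀ s : ℝ, 0 < s → s < 1 → ∀ μ : ProbabilityMeasure (Grassmannian 𝕜 1 d),
        IsMinOn (kaczmarzFunctional s) Set.univ μ ↔ μ = Γ) ∧
      (∀ μ : ProbabilityMeasure (Grassmannian 𝕜 1 d),
        IsMinOn logKaczmarzFunctional Set.univ μ ↔ μ = Γ) := by
  have : Nonempty (Grassmannian 𝕜 1 d) := Grassmannian.nonempty_of_pos (by omega)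
  let Γ : ProbabilityMeasure (Grassmannian 𝕜 1 d) := ⟨Grassmannian.uniform, inferInstance⟩
  have : (Γ : Measure (Grassmannian 𝕜 1 d)).IsOpenPosMeasure :=
    inferInstanceAs (Grassmannian.uniform : Measure (Grassmannian 𝕜 1 d)).IsOpenPosMeasure
  have hinv : ∀ g : Hd 𝕜 d ≃ₗᵢ[𝕜] Hd 𝕜 d,
      (Γ : Measure (Grassmannian 𝕜 1 d)).map (Grassmannian.image g) = Γ :=
    Grassmannian.map_image_uniform
  obtain ⟨γ, hΓ⟩ := Grassmannian.exists_integral_overlap_pow_eq hinv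
  refine ⟨Γ, fun μ => ⟨fun h => ?_, ?_⟩, fun s hs0 hs1 => ?_, ?_⟩
  · obtain ⟨γ', hμ⟩ := Grassmannian.exists_integral_overlap_pow_eq
      ((Grassmannian.isInvariant_iff μ).1 h)
    exact ProbabilityMeasure.toMeasure_injective (Grassmannian.eq_of_isotropic hΓ hμ)
  · rintro rfl
    exact (Grassmannian.isInvariant_iff _).2 hinv
  · exact isMinOn_univ_iff_eq_of_le_imp_eq fun μ h =>
      Grassmannian.eq_of_kaczmarzFunctional_le hs0 hs1 hΓ h
  · exact isMinOn_univ_iff_eq_of_le_imp_eq fun μ h =>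
      Grassmannian.eq_of_logKaczmarzFunctional_le hd hΓ h
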